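/- Let $\mathbb{H}$ be the real quaternion division ring, with $\mathbb{R}\subset\mathbb{H}$ its center, and let $\mathbb{R}\langle\mathcal{X}\rangle$ be the free associative unital $\mathbb{R}$-algebra on countably many noncommuting variables. For $p\in\mathbb{R}\langle\mathcal{X}\rangle$ and a unital associative $\mathbb{R}$-algebra $\mathcal{A}$, let $p(\mathcal{A})\subseteq\mathcal{A}$ denote the set of all values of $p$ under substitutions of elements of $\mathcal{A}$ for the variables. Call $p$ multilinear if there are an integer $m\ge 1$, distinct variables $y_1,\dots,y_m\in\mathcal{X}$ and real numbers $\lambda_\sigma$ ($\sigma\in S_m$) with $p=\sum_{\sigma\in S_m}\lambda_\sigma\, y_{\sigma(1)}y_{\sigma(2)}\cdots y_{\sigma(m)}$. Let $\mathrm{GL}_n(\mathbb{H})$ be the group of invertible matrices in $\mathrm{M}_n(\mathbb{H})$, and let $\mathrm{SL}_n(\mathbb{H})$ be the subgroup of $\mathrm{GL}_n(\mathbb{H})$ generated by all multiplicative commutators $xyx^{-1}y^{-1}$ with $x,y\in\mathrm{GL}_n(\mathbb{H})$. **Theorem.** Let $n\ge 2$ be an integer. (i) Let $p_1,\dots,p_4\in\mathbb{R}\langle\mathcal{X}\rangle$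 be multilinear polynomials with $p_i(\mathbb{H})\ne\{0\}$ and $p_i(\mathbb{H})\ne\mathbb{R}$ for each $i$. Then for every $B\in\mathrm{SL}_n(\mathbb{H})$ there are invertible matrices $A_i\in p_i(\mathrm{M}_n(\mathbb{H}))$, $i=1,\dots,4$, such that $$B=A_1A_2A_1^{-1}A_2^{-1}\,A_3A_4A_3^{-1}A_4^{-1}.$$ (ii) Let $p_1,\dots,p_8\in\mathbb{R}\langle\mathcal{X}\rangle$ be multilinear polynomials with $p_i(\mathbb{H})\ne\{0\}$ and $p_i(\mathbb{H})\ne\mathbb{R}$ for each $i$. Then for every matrix $B\in\mathrm{M}_n(\mathbb{H})$ there are invertible matrices $A_i\in p_i(\mathrm{M}_n(\mathbb{H}))$, $i=1,\dots,8$, such that $$B=A_1A_2A_1^{-1}A_2^{-1}\,A_3A_4A_3^{-1}A_4^{-1}-A_5A_6A_5^{-1}A_6^{-1}\,A_7A_8A_7^{-1}A_8^{-1}.$$ -/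

import Mathlib

open scoped Quaternion

noncomputable section

/-- The image `p(𝒜)` of a noncommutative polynomial `p ∈ ℝ⟨x₀, x₁, x₂, …⟩` on a unital associative
real algebra `𝒜`: the set of all values of `p` under substitutions of elements of `𝒜` for the
variables. -/
def polyImage (p : FreeAlgebra ℝ ℕ) (𝒜 : Type*) [Ring 𝒜] [Algebra ℝ 𝒜] : Set 𝒜 :=
  Set.range fun a : ℕ → 𝒜 => FreeAlgebra.lift ℝ a p

/-- `p` is multilinear: for some `m ≥ 1` and some `m` distinct variables `y₁, …, yₘ` it is of the
form `∑_{σ ∈ Sₘ} c_σ y_{σ(1)} y_{σ(2)} ⋯ y_{σ(m)}` with real coefficients `c_σ`. -/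
def IsMultilinearPoly (p : FreeAlgebra ℝ ℕ) : Prop :=
  ∃ (m : ℕ) (v : Fin m → ℕ) (c : Equiv.Perm (Fin m) → ℝ), 0 < m ∧ Function.Injective v ∧
    p = ∑ σ : Equiv.Perm (Fin m),
      c σ • (List.ofFn fun i : Fin m => FreeAlgebra.ι ℝ (v (σ i))).prod

/-- The general linear group `GLₙ(ℍ)` over the real quaternions: the unit group of `Mₙ(ℍ)`. -/
abbrev QuatGL (n : ℕ) : Type := (Matrix (Fin n) (Fin n) ℍ[ℝ])ˣ

/-- The special linear group `SLₙ(ℍ)` over the real quaternions: the subgroup of `GLₙ(ℍ)`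
generated by all multiplicative commutators `x y x⁻¹ y⁻¹`. -/
def QuatSL (n : ℕ) : Subgroup (QuatGL n) := commutator (QuatGL n)

end

/-!
The evaluation of a multilinear polynomial respects the grading of `ℍ` by the Klein four-group, so
that `p(ℍ)`, unless it is `{0}` or `ℝ`, contains a nonzero pure quaternion. By homogeneity and
conjugation it contains all of them, and `p(Mₙ(ℍ))` contains every matrix similar to a diagonal
matrix of pure quaternions.

A triangular matrix with diagonal entries of norm `1` is a commutator of two such matrices: each
unit quaternion is a commutator of pure quaternions whose norm can be chosen freely, and a
triangular matrix whose diagonal entries have distinct norms is similar to its diagonal.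

Every matrix over a division ring is similar to a product `L D U`, where `L` and `U` are
unitriangular and the entries of the diagonal matrix `D` other than `1` coincide. If the
determinant is `1`, these entries therefore have norm `1`, and `(L D) U` is a product of two
commutators. In general, if `σ` is the matrix of a permutation without fixed points, then `D σ` has
zero diagonal and is a difference `V - W` of unitriangular matrices, and
`L D U = L V σ⁻¹ U - L W σ⁻¹ U` is a difference of matrices of determinant `±1`.
-/

open scoped commutatorElement

section PolyImage

variable {p : FreeAlgebra ℝ ℕ} {A B ι : Type*} [Ring A] [Algebra ℝ A] [Ring B] [Algebra ℝ B]

theorem map_mem_polyImage (f : A →ₐ[ℝ] B) {x : A} (hx : x ∈ polyImage p A) :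
    f x ∈ polyImage p B := by
  obtain ⟨a, rfl⟩ := hx
  have hlift : FreeAlgebra.lift ℝ (fun k => f (a k)) = f.comp (FreeAlgebra.lift ℝ a) := by
    ext k; simp
  exact ⟨fun k => f (a k), congrArg (· p) hlift⟩

theorem mem_polyImage_of_isConj {x y : A} (h : IsConj x y) (hx : x ∈ polyImage p A) :
    y ∈ polyImage p A := by
  obtain ⟨u, hu⟩ := h
  have := map_mem_polyImage (MulSemiringAction.toAlgHom ℝ A (ConjAct.toConjAct u)) hx
  rwa [MulSemiringAction.toAlgHom_apply, ConjAct.units_smul_def, ConjAct.ofConjAct_toConjAct,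
    hu.eq, Units.mul_inv_cancel_right] at this

theorem pi_mem_polyImage {d : ι → A} (hd : ∀ i, d i ∈ polyImage p A) :
    d ∈ polyImage p (ι → A) := by
  choose a ha using hd
  refine ⟨fun k i => a i k, funext fun i => ?_⟩
  have hlift : (Pi.evalAlgHom ℝ (fun _ : ι => A) i).comp (FreeAlgebra.lift ℝ fun k i => a i k) =
      FreeAlgebra.lift ℝ (a i) := by
    ext k; simp
  exact (congrArg (· p) hlift).trans (ha i)

theorem diagonal_mem_polyImage [Fintype ι] [DecidableEq ι] {d : ι → A}
    (hd : ∀ i, d i ∈ polyImage p A) : Matrix.diagonal d ∈ polyImage p (Matrix ι ι A) :=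
  map_mem_polyImage (Matrix.diagonalAlgHom ℝ) (pi_mem_polyImage hd)

/-- The evaluation map of the multilinear polynomial with coefficients `c`. -/
def multilinearEval {m : ℕ} (c : Equiv.Perm (Fin m) → ℝ) (A : Type*) [Ring A] [Algebra ℝ A] :
    MultilinearMap ℝ (fun _ : Fin m => A) A :=
  ∑ σ : Equiv.Perm (Fin m), c σ • (MultilinearMap.mkPiAlgebraFin ℝ m A).domDomCongr σ

theorem multilinearEval_apply {m : ℕ} (c : Equiv.Perm (Fin m) → ℝ) (x : Fin m → A) :
    multilinearEval c A x = ∑ σ, c σ • (List.ofFn fun i => x (σ i)).prod := by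
  simp [multilinearEval]

theorem multilinearEval_mem_graded {G : Type*} [AddCommMonoid G] {𝒜 : G → Submodule ℝ A}
    [SetLike.GradedMonoid 𝒜] {m : ℕ} (c : Equiv.Perm (Fin m) → ℝ) {x : Fin m → A} {g : Fin m → G}
    (hx : ∀ i, x i ∈ 𝒜 (g i)) : multilinearEval c A x ∈ 𝒜 (∑ i, g i) := by
  rw [multilinearEval_apply]
  refine sum_mem fun σ _ => Submodule.smul_mem _ _ ?_
  rw [← Equiv.sum_comp σ, ← List.sum_ofFn]
  exact SetLike.list_prod_ofFn_mem_graded _ _ fun i => hx (σ i)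

theorem IsMultilinearPoly.exists_polyImage_eq_range (hp : IsMultilinearPoly p) :
    ∃ (m : ℕ) (c : Equiv.Perm (Fin m) → ℝ), 0 < m ∧
      polyImage p A = Set.range (multilinearEval c A) := by
  obtain ⟨m, v, c, hm, hv, rfl⟩ := hp
  have hlift (a : ℕ → A) : FreeAlgebra.lift ℝ a (∑ σ : Equiv.Perm (Fin m),
      c σ • (List.ofFn fun i : Fin m => FreeAlgebra.ι ℝ (v (σ i))).prod) =
      multilinearEval c A (a ∘ v) := by
    simp [multilinearEval_apply, map_list_prod, List.map_ofFn, Function.comp_def]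
  refine ⟨m, c, hm, Set.Subset.antisymm ?_ ?_⟩
  · rintro _ ⟨a, rfl⟩
    exact ⟨a ∘ v, (hlift a).symm⟩
  · rintro _ ⟨x, rfl⟩
    exact ⟨Function.extend v x 0, (hlift _).trans (congrArg _ (Function.extend_comp hv x 0))⟩

theorem IsMultilinearPoly.smul_mem_polyImage (hp : IsMultilinearPoly p) (r : ℝ) {x : A}
    (hx : x ∈ polyImage p A) : r • x ∈ polyImage p A := by
  obtain ⟨m, c, hm, h⟩ := hp.exists_polyImage_eq_range (A := A)
  rw [h] at hx ⊢
  obtain ⟨y, rfl⟩ := hx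
  refine ⟨Function.update y ⟨0, hm⟩ (r • y ⟨0, hm⟩), ?_⟩
  rw [MultilinearMap.map_update_smul, Function.update_eq_self]

end PolyImage

section PureQuaternion

theorem mul_self_eq_neg_sq_norm_of_re_eq_zero {q : ℍ[ℝ]} (hq : q.re = 0) :
    q * q = -((‖q‖ ^ 2 : ℝ) : ℍ[ℝ]) := by
  rw [sq, ← Quaternion.normSq_eq_norm_mul_self, ← Quaternion.self_mul_star,
    Quaternion.star_eq_neg.mpr hq, mul_neg, neg_neg]

theorem mul_eq_neg_mul_of_re_eq_zero {x y : ℍ[ℝ]} (hx : x.re = 0) (hy : y.re = 0)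
    (hxy : (x * y).re = 0) : x * y = -(y * x) := by
  have h := Quaternion.star_eq_neg.mpr hxy
  rw [star_mul, Quaternion.star_eq_neg.mpr hx, Quaternion.star_eq_neg.mpr hy, neg_mul_neg] at h
  rw [h, neg_neg]

theorem exists_pure_unit_re_mul_eq_zero (w : ℍ[ℝ]) :
    ∃ x : ℍ[ℝ], x.re = 0 ∧ ‖x‖ = 1 ∧ (w * x).re = 0 := by
  let re : ℍ[ℝ] →ₗ[ℝ] ℝ := QuaternionAlgebra.reₗ (-1) 0 (-1)
  obtain ⟨x, hx, hx0⟩ := (Submodule.ne_bot_iff _).mp <| LinearMap.ker_ne_bot_of_finrank_lt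
    (f := re.prod (re.comp (LinearMap.mulLeft ℝ w))) (by simp [Quaternion.finrank_eq_four])
  obtain ⟨hre, hwre⟩ : x.re = 0 ∧ (w * x).re = 0 := Prod.ext_iff.mp hx
  refine ⟨‖x‖⁻¹ • x, ?_, norm_smul_inv_norm hx0, ?_⟩
  · rw [Quaternion.re_smul, hre, smul_zero]
  · rw [mul_smul_comm, Quaternion.re_smul, hwre, smul_zero]

theorem exists_pure_unit_mul_eq_mul {x y : ℍ[ℝ]} (hx : x.re = 0) (hy : y.re = 0)
    (hxy : ‖x‖ = ‖y‖) : ∃ g : ℍ[ℝ], g.re = 0 ∧ ‖g‖ = 1 ∧ g * x = y * g := by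
  by_cases hsum : x + y = 0
  · obtain ⟨g, hg, hg1, hxg⟩ := exists_pure_unit_re_mul_eq_zero x
    refine ⟨g, hg, hg1, ?_⟩
    rw [eq_neg_of_add_eq_zero_right hsum, neg_mul, mul_eq_neg_mul_of_re_eq_zero hx hg hxg, neg_neg]
  · refine ⟨‖x + y‖⁻¹ • (x + y), ?_, norm_smul_inv_norm hsum, ?_⟩
    · rw [Quaternion.re_smul, Quaternion.re_add, hx, hy, add_zero, smul_zero]
    · rw [smul_mul_assoc, mul_smul_comm, add_mul, mul_add,
        mul_self_eq_neg_sq_norm_of_re_eq_zero hx, hxy, ← mul_self_eq_neg_sq_norm_of_re_eq_zero hy,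
        add_comm (y * y)]

theorem isConj_of_re_eq_zero_of_norm_eq {x y : ℍ[ℝ]} (hx : x.re = 0) (hy : y.re = 0)
    (hxy : ‖x‖ = ‖y‖) : IsConj x y := by
  obtain ⟨g, -, hg, h⟩ := exists_pure_unit_mul_eq_mul hx hy hxy
  exact ⟨Units.mk0 g (norm_ne_zero_iff.mp (hg ▸ one_ne_zero)), h⟩

theorem exists_pure_mul_eq_mul_mul {u : ℍ[ℝ]} (hu : ‖u‖ = 1) {r : ℝ} (hr : 0 ≤ r) :
    ∃ x y : ℍ[ℝ], x.re = 0 ∧ ‖x‖ = r ∧ y.re = 0 ∧ ‖y‖ = r ∧ x * y = u * y * x := by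
  obtain ⟨y, hy, hy1, huy⟩ := exists_pure_unit_re_mul_eq_zero u
  obtain ⟨x, hx, hx1, hxy⟩ := exists_pure_unit_mul_eq_mul hy huy (by rw [norm_mul, hu, one_mul])
  have hnorm {q : ℍ[ℝ]} (hq : ‖q‖ = 1) : ‖r • q‖ = r := by
    rw [norm_smul, hq, mul_one, Real.norm_of_nonneg hr]
  refine ⟨r • x, r • y, by simp [hx], hnorm hx1, by simp [hy], hnorm hy1, ?_⟩
  simp only [smul_mul_assoc, mul_smul_comm, hxy]

end PureQuaternion

section KleinGrading

/-- The grading of the quaternions by the Klein four-group in which `1, i, j, k` have the degrees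
`(0, 0), (1, 0), (0, 1), (1, 1)`. -/
def kleinGrading (g : ZMod 2 × ZMod 2) : Submodule ℝ ℍ[ℝ] where
  carrier := {q | (g ≠ (0, 0) → q.re = 0) ∧ (g ≠ (1, 0) → q.imI = 0) ∧
    (g ≠ (0, 1) → q.imJ = 0) ∧ (g ≠ (1, 1) → q.imK = 0)}
  zero_mem' := by simp
  add_mem' := by simp +contextual
  smul_mem' := by simp +contextual

instance kleinGrading.gradedMonoid : SetLike.GradedMonoid kleinGrading where
  one_mem := by simp [kleinGrading, Prod.zero_eq_mk]
  mul_mem := by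
    rintro ⟨a, b⟩ ⟨a', b'⟩ x y ⟨hx, hxi, hxj, hxk⟩ ⟨hy, hyi, hyj, hyk⟩
    fin_cases a <;> fin_cases b <;> fin_cases a' <;> fin_cases b' <;>
      simp_all +decide [kleinGrading]

theorem re_eq_zero_or_mem_range_of_mem_kleinGrading {g : ZMod 2 × ZMod 2} {q : ℍ[ℝ]}
    (hq : q ∈ kleinGrading g) : q.re = 0 ∨ q ∈ Set.range (algebraMap ℝ ℍ[ℝ]) := by
  obtain ⟨hre, hI, hJ, hK⟩ := hq
  by_cases hg : g = (0, 0)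
  · subst hg
    exact .inr ⟨q.re, by ext <;> simp [hI, hJ, hK]⟩
  · exact .inl (hre hg)

/-- The real basis `1, i, j, k` of the quaternions. -/
noncomputable def quaternionBasis : Module.Basis (Fin 4) ℝ ℍ[ℝ] :=
  QuaternionAlgebra.basisOneIJK (-1) 0 (-1)

theorem quaternionBasis_mem_kleinGrading (i : Fin 4) :
    quaternionBasis i ∈ kleinGrading (![(0, 0), (1, 0), (0, 1), (1, 1)] i) := by
  have hrepr (q : ℍ[ℝ]) : quaternionBasis.repr q = ![q.re, q.imI, q.imJ, q.imK] := rfl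
  have hcoord (j : Fin 4) := congrFun (hrepr (quaternionBasis i)) j
  simp only [Module.Basis.repr_self, Finsupp.single_apply] at hcoord
  refine ⟨fun hi => (hcoord 0).symm.trans ?_, fun hi => (hcoord 1).symm.trans ?_,
    fun hi => (hcoord 2).symm.trans ?_, fun hi => (hcoord 3).symm.trans ?_⟩ <;>
  · refine if_neg ?_
    rintro rfl
    exact hi rfl

theorem multilinearEval_quaternion_mem_range {m : ℕ} {c : Equiv.Perm (Fin m) → ℝ}
    (h : ∀ x, (multilinearEval c ℍ[ℝ] x).re = 0 → multilinearEval c ℍ[ℝ] x = 0) (x : Fin m → ℍ[ℝ]) :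
    multilinearEval c ℍ[ℝ] x ∈ Set.range (algebraMap ℝ ℍ[ℝ]) := by
  let R : Submodule ℝ ℍ[ℝ] := LinearMap.range (Algebra.linearMap ℝ ℍ[ℝ])
  suffices R.mkQ.compMultilinearMap (multilinearEval c ℍ[ℝ]) = 0 from
    (Submodule.Quotient.mk_eq_zero R).mp (DFunLike.congr_fun this x)
  refine Module.Basis.ext_multilinear (fun _ => quaternionBasis) fun v => ?_
  refine (Submodule.Quotient.mk_eq_zero R).mpr ?_
  have hgr := multilinearEval_mem_graded c fun i => quaternionBasis_mem_kleinGrading (v i)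
  rcases re_eq_zero_or_mem_range_of_mem_kleinGrading hgr with hre | hR
  · rw [h _ hre]
    exact R.zero_mem
  · exact hR

theorem IsMultilinearPoly.exists_pure_mem_polyImage {p : FreeAlgebra ℝ ℕ}
    (hp : IsMultilinearPoly p) (h0 : polyImage p ℍ[ℝ] ≠ {0})
    (hR : polyImage p ℍ[ℝ] ≠ Set.range (algebraMap ℝ ℍ[ℝ])) :
    ∃ q ∈ polyImage p ℍ[ℝ], q ≠ 0 ∧ q.re = 0 := by
  by_contra! hpure
  obtain ⟨m, c, -, himage⟩ := hp.exists_polyImage_eq_range (A := ℍ[ℝ])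
  have hreal : polyImage p ℍ[ℝ] ⊆ Set.range (algebraMap ℝ ℍ[ℝ]) := by
    rw [himage]
    rintro _ ⟨x, rfl⟩
    refine multilinearEval_quaternion_mem_range (fun y hy => ?_) x
    by_contra hne
    exact hpure _ (himage ▸ ⟨y, rfl⟩) hne hy
  obtain ⟨_, hq, hq0⟩ : ∃ q ∈ polyImage p ℍ[ℝ], q ≠ 0 := by
    by_contra! hzero
    refine h0 (Set.Subset.antisymm hzero (Set.singleton_subset_iff.mpr ?_))
    simpa using hp.smul_mem_polyImage 0 ⟨(0 : ℕ → ℍ[ℝ]), rfl⟩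
  obtain ⟨r, rfl⟩ := hreal hq
  have hr : r ≠ 0 := fun h => hq0 (by rw [h, map_zero])
  refine hR (hreal.antisymm ?_)
  rintro _ ⟨s, rfl⟩
  have hs := hp.smul_mem_polyImage (s / r) hq
  rwa [Algebra.smul_def, ← map_mul, div_mul_cancel₀ _ hr] at hs

theorem IsMultilinearPoly.mem_polyImage_of_re_eq_zero {p : FreeAlgebra ℝ ℕ}
    (hp : IsMultilinearPoly p) (h0 : polyImage p ℍ[ℝ] ≠ {0})
    (hR : polyImage p ℍ[ℝ] ≠ Set.range (algebraMap ℝ ℍ[ℝ])) {x : ℍ[ℝ]} (hx : x.re = 0) :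
    x ∈ polyImage p ℍ[ℝ] := by
  obtain ⟨q, hq, hq0, hre⟩ := hp.exists_pure_mem_polyImage h0 hR
  have hnorm : ‖(‖x‖ / ‖q‖) • q‖ = ‖x‖ := by
    rw [norm_smul, Real.norm_of_nonneg (by positivity),
      div_mul_cancel₀ _ (norm_ne_zero_iff.mpr hq0)]
  have hconj : IsConj ((‖x‖ / ‖q‖) • q) x :=
    isConj_of_re_eq_zero_of_norm_eq (by simp [hre]) hx hnorm
  exact mem_polyImage_of_isConj hconj (hp.smul_mem_polyImage _ hq)

end KleinGrading

section Unitriangular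

variable {ι κ α K : Type*} [LinearOrder α] [Zero K] [One K] {b : ι → α} {b' : κ → α}

/-- Upper triangular matrices, in the order of the indices given by `b`, with ones on the
diagonal. -/
structure IsUnitriangular (b : ι → α) (M : Matrix ι ι K) : Prop where
  blockTriangular : M.BlockTriangular b
  apply_self (i : ι) : M i i = 1

theorem isUnitriangular_one [DecidableEq ι] (b : ι → α) : IsUnitriangular b (1 : Matrix ι ι K) :=
  ⟨Matrix.blockTriangular_one, Matrix.one_apply_eq⟩

theorem IsUnitriangular.of_lt_imp_lt {β : Type*} [LinearOrder β] {c : ι → β} {M : Matrix ι ι K}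
    (hM : IsUnitriangular b M) (hcb : ∀ i j, c i < c j → b i < b j) : IsUnitriangular c M :=
  ⟨fun _ _ hij => hM.blockTriangular (hcb _ _ hij), hM.apply_self⟩

theorem IsUnitriangular.submatrix {M : Matrix ι ι K} (hM : IsUnitriangular b M) (e : κ → ι) :
    IsUnitriangular (b ∘ e) (M.submatrix e e) :=
  ⟨hM.blockTriangular.submatrix, fun i => hM.apply_self (e i)⟩

theorem IsUnitriangular.fromBlocks_zero₂₁ {A : Matrix ι ι K} {D : Matrix κ κ K}
    (hA : IsUnitriangular b A) (hD : IsUnitriangular b' D) (hb : ∀ i j, b i ≤ b' j)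
    (B : Matrix ι κ K) : IsUnitriangular (Sum.elim b b') (Matrix.fromBlocks A B 0 D) where
  blockTriangular := by
    rintro (i | i) (j | j) hij
    exacts [hA.blockTriangular hij, absurd hij (hb i j).not_gt, rfl, hD.blockTriangular hij]
  apply_self := by
    rintro (i | i)
    exacts [hA.apply_self i, hD.apply_self i]

theorem IsUnitriangular.fromBlocks_zero₁₂ {A : Matrix ι ι K} {D : Matrix κ κ K}
    (hA : IsUnitriangular b A) (hD : IsUnitriangular b' D) (hb : ∀ i j, b' j ≤ b i)
    (C : Matrix κ ι K) : IsUnitriangular (Sum.elim b b') (Matrix.fromBlocks A 0 C D) where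
  blockTriangular := by
    rintro (i | i) (j | j) hij
    exacts [hA.blockTriangular hij, rfl, absurd hij (hb j i).not_gt, hD.blockTriangular hij]
  apply_self := by
    rintro (i | i)
    exacts [hA.apply_self i, hD.apply_self i]

end Unitriangular

section Triangular

variable {ι α K : Type*} [Fintype ι] [LinearOrder α] {b : ι → α}

theorem exists_blockTriangular_mul_apply [NonUnitalNonAssocSemiring K] {A X : Matrix ι ι K}
    (hb : b.Injective) (hA : A.BlockTriangular b) {i j : ι} (hij : X i j ≠ 0) :
    ∃ k, b i ≤ b k ∧ X k j ≠ 0 ∧ (A * X) k j = A k k * X k j := by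
  classical
  obtain ⟨k, hk, hmax⟩ := (Finset.univ.filter (X · j ≠ 0)).exists_max_image b ⟨i, by simpa⟩
  simp only [Finset.mem_filter, Finset.mem_univ, true_and] at hk hmax
  refine ⟨k, hmax i hij, hk, ?_⟩
  rw [Matrix.mul_apply]
  refine Finset.sum_eq_single_of_mem k (Finset.mem_univ k) fun l _ hlk => ?_
  by_cases hl : X l j = 0
  · rw [hl, mul_zero]
  · rw [hA (lt_of_le_of_ne (hmax l hl) (hb.ne hlk)), zero_mul]

/-- The strictly upper triangular matrices in the order of the indices given by `b`. -/
def strictlyTriangular (F K : Type*) [Semiring F] [AddCommMonoid K] [Module F K] (b : ι → α) :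
    Submodule F (Matrix ι ι K) where
  carrier := {X | ∀ ⦃i j⦄, b j ≤ b i → X i j = 0}
  zero_mem' := fun _ _ _ => rfl
  add_mem' := fun hX hY i j hij => by rw [Matrix.add_apply, hX hij, hY hij, add_zero]
  smul_mem' := fun r X hX i j hij => by rw [Matrix.smul_apply, hX hij, smul_zero]

theorem mul_mem_strictlyTriangular {F : Type*} [Semiring F] [NonUnitalNonAssocSemiring K]
    [Module F K] {A X : Matrix ι ι K}
    (hA : A.BlockTriangular b) (hX : X ∈ strictlyTriangular F K b) :
    A * X ∈ strictlyTriangular F K b := by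
  intro i j hij
  rw [Matrix.mul_apply]
  refine Finset.sum_eq_zero fun k _ => ?_
  rcases lt_or_ge (b k) (b i) with hki | hik
  · rw [hA hki, zero_mul]
  · rw [hX (hij.trans hik), mul_zero]

theorem mul_diagonal_mem_strictlyTriangular {F : Type*} [Semiring F]
    [NonUnitalNonAssocSemiring K] [Module F K] [DecidableEq ι] {X : Matrix ι ι K}
    (hX : X ∈ strictlyTriangular F K b) (d : ι → K) :
    X * Matrix.diagonal d ∈ strictlyTriangular F K b := by
  intro i j hij
  rw [Matrix.mul_diagonal, hX hij, zero_mul]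

/-- The Sylvester operator `X ↦ A X - X D` on strictly triangular matrices. -/
def sylvester (F : Type*) [CommRing F] [Ring K] [Algebra F K] [DecidableEq ι]
    {A : Matrix ι ι K} (hA : A.BlockTriangular b) (d : ι → K) :
    strictlyTriangular F K b →ₗ[F] strictlyTriangular F K b :=
  LinearMap.restrict
    (LinearMap.mulLeft F A - LinearMap.mulRight F (Matrix.diagonal d)) fun _ hX =>
    sub_mem (mul_mem_strictlyTriangular hA hX) (mul_diagonal_mem_strictlyTriangular hX d)

theorem sylvester_injective (F : Type*) [CommRing F] [Ring K] [Algebra F K] [DecidableEq ι]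
    {A : Matrix ι ι K} (hb : b.Injective) (hA : A.BlockTriangular b) {d : ι → K}
    (h : ∀ i j, i ≠ j → ∀ z, A i i * z = z * d j → z = 0) :
    Function.Injective (sylvester F hA d) := by
  rw [injective_iff_map_eq_zero]
  rintro ⟨X, hX⟩ hAX
  have hAX : A * X - X * Matrix.diagonal d = 0 := congrArg Subtype.val hAX
  ext i j
  by_contra! hij
  obtain ⟨k, -, hkj, hk⟩ := exists_blockTriangular_mul_apply hb hA hij
  refine hkj (h k j (fun hkj' => hkj (hX (by rw [hkj']))) _ ?_)
  rw [← hk, sub_eq_zero.mp hAX, Matrix.mul_diagonal]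

variable [DivisionRing K] [DecidableEq ι]

theorem isUnit_of_blockTriangular {A : Matrix ι ι K} (hb : b.Injective)
    (hA : A.BlockTriangular b) (h : ∀ i, A i i ≠ 0) : IsUnit A := by
  rw [IsArtinianRing.isUnit_iff_isLeftRegular, isLeftRegular_iff_right_eq_zero_of_mul]
  intro X hAX
  by_contra! hX
  obtain ⟨i, j, hij⟩ : ∃ i j, X i j ≠ 0 := by
    by_contra! hzero
    exact hX (Matrix.ext hzero)
  obtain ⟨k, -, hkj, hk⟩ := exists_blockTriangular_mul_apply hb hA hij
  rw [hAX, Matrix.zero_apply] at hk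
  exact mul_ne_zero (h k) hkj hk.symm

theorem IsUnitriangular.isUnit {M : Matrix ι ι K} (hM : IsUnitriangular b M) (hb : b.Injective) :
    IsUnit M :=
  isUnit_of_blockTriangular hb hM.blockTriangular fun i => hM.apply_self i ▸ one_ne_zero

theorem exists_isUnitriangular_mul_eq_mul_diagonal (F : Type*) [Field F] [Algebra F K]
    [FiniteDimensional F K] {A : Matrix ι ι K} (hb : b.Injective) (hA : A.BlockTriangular b)
    (h : ∀ i j, i ≠ j → ∀ z, A i i * z = z * A j j → z = 0) :
    ∃ P, IsUnitriangular b P ∧ A * P = P * Matrix.diagonal A.diag := by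
  have hD : Matrix.diagonal A.diag - A ∈ strictlyTriangular F K b := by
    intro i j hij
    rcases hij.eq_or_lt with heq | hlt
    · obtain rfl := hb heq
      simp
    · rw [Matrix.sub_apply, hA hlt, Matrix.diagonal_apply_ne _ (ne_of_apply_ne b hlt.ne'), sub_zero]
  obtain ⟨⟨N, hN⟩, hAN⟩ :=
    LinearMap.injective_iff_surjective.mp (sylvester_injective F hb hA h) ⟨_, hD⟩
  have hAN : A * N - N * Matrix.diagonal A.diag = Matrix.diagonal A.diag - A :=
    congrArg Subtype.val hAN
  refine ⟨1 + N, ⟨Matrix.blockTriangular_one.add fun i j hij => hN hij.le, fun i => ?_⟩, ?_⟩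
  · rw [Matrix.add_apply, Matrix.one_apply_eq, hN le_rfl, add_zero]
  · rw [mul_add, add_mul, mul_one, one_mul, add_comm, sub_eq_sub_iff_add_eq_add.mp hAN]

end Triangular

section PureDiagonalizable

variable {ι : Type*} [Fintype ι] [DecidableEq ι]

/-- Similarity to a diagonal matrix of pure quaternions, the form in which the values of the given
polynomials are found. -/
def IsPureDiagonalizable (X : Matrix ι ι ℍ[ℝ]) : Prop :=
  ∃ d : ι → ℍ[ℝ], (∀ i, (d i).re = 0) ∧ IsConj (Matrix.diagonal d) X

theorem IsPureDiagonalizable.of_isConj {X Y : Matrix ι ι ℍ[ℝ]} (hX : IsPureDiagonalizable X)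
    (hXY : IsConj X Y) : IsPureDiagonalizable Y :=
  let ⟨d, hd, hdX⟩ := hX
  ⟨d, hd, hdX.trans hXY⟩

theorem IsPureDiagonalizable.mem_polyImage {X : Matrix ι ι ℍ[ℝ]} (hX : IsPureDiagonalizable X)
    {p : FreeAlgebra ℝ ℕ} (hp : IsMultilinearPoly p) (h0 : polyImage p ℍ[ℝ] ≠ {0})
    (hR : polyImage p ℍ[ℝ] ≠ Set.range (algebraMap ℝ ℍ[ℝ])) :
    X ∈ polyImage p (Matrix ι ι ℍ[ℝ]) := by
  obtain ⟨d, hd, hdX⟩ := hX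
  exact mem_polyImage_of_isConj hdX <|
    diagonal_mem_polyImage fun i => hp.mem_polyImage_of_re_eq_zero h0 hR (hd i)

theorem eq_zero_of_mul_eq_mul_of_norm_ne {K : Type*} [NormedDivisionRing K] {a b z : K}
    (hab : ‖a‖ ≠ ‖b‖) (hz : a * z = z * b) :
    z = 0 := by
  by_contra hz0
  refine hab (mul_right_cancel₀ (norm_ne_zero_iff.mpr hz0) ?_)
  rw [← norm_mul, hz, norm_mul, mul_comm]

variable {α : Type*} [LinearOrder α] {b : ι → α}

theorem exists_isUnitriangular_mul_eq_mul_diagonal_of_norm {A : Matrix ι ι ℍ[ℝ]}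
    (hb : b.Injective) (hA : A.BlockTriangular b) (hnorm : Function.Injective fun i => ‖A i i‖) :
    ∃ P, IsUnitriangular b P ∧ A * P = P * Matrix.diagonal A.diag :=
  exists_isUnitriangular_mul_eq_mul_diagonal ℝ hb hA fun _ _ hij _ =>
    eq_zero_of_mul_eq_mul_of_norm_ne (hnorm.ne hij)

theorem isPureDiagonalizable_of_blockTriangular {A : Matrix ι ι ℍ[ℝ]} (hb : b.Injective)
    (hA : A.BlockTriangular b) (hre : ∀ i, (A i i).re = 0)
    (hnorm : Function.Injective fun i => ‖A i i‖) : IsPureDiagonalizable A := by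
  obtain ⟨P, hP, hAP⟩ := exists_isUnitriangular_mul_eq_mul_diagonal_of_norm hb hA hnorm
  exact ⟨A.diag, hre, (hP.isUnit hb).unit, hAP.symm⟩

theorem exists_commutator_of_blockTriangular {T : Matrix ι ι ℍ[ℝ]} (hb : b.Injective)
    (hT : T.BlockTriangular b) (hdiag : ∀ i, ‖T i i‖ = 1) :
    ∃ X Y : (Matrix ι ι ℍ[ℝ])ˣ, IsPureDiagonalizable (X : Matrix ι ι ℍ[ℝ]) ∧
      IsPureDiagonalizable (Y : Matrix ι ι ℍ[ℝ]) ∧ T = ↑⁅X, Y⁆ := by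
  let r : ι → ℝ := fun i => Fintype.equivFin ι i + 1
  have hr : r.Injective := fun i j hij => by simpa [r, Fin.val_inj] using hij
  have hr0 (i : ι) : 0 < r i := by positivity
  choose x y hx hxr hy hyr hxy using fun i => exists_pure_mul_eq_mul_mul (hdiag i) (hr0 i).le
  have hne {q : ι → ℍ[ℝ]} (hq : ∀ i, ‖q i‖ = r i) (i : ι) : q i ≠ 0 :=
    norm_ne_zero_iff.mp (hq i ▸ (hr0 i).ne')
  set D : Matrix ι ι ℍ[ℝ] := Matrix.diagonal x
  set Y : Matrix ι ι ℍ[ℝ] := Matrix.diagonal y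
  have hTY : (T * Y).BlockTriangular b := hT.mul (Matrix.blockTriangular_diagonal y)
  have hTYii (i : ι) : (T * Y) i i = T i i * y i := Matrix.mul_diagonal _ _ _ _
  obtain ⟨P, hP, hTYP⟩ := exists_isUnitriangular_mul_eq_mul_diagonal_of_norm hb hTY fun i j hij =>
    hr (by simpa [hTYii, hdiag, hyr] using hij)
  -- `X = P D` solves `T Y X = X Y` because `u y x = x y` for the diagonal entries.
  have hX : (P * D).BlockTriangular b :=
    hP.blockTriangular.mul (Matrix.blockTriangular_diagonal x)
  have hXii (i : ι) : (P * D) i i = x i := by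
    rw [Matrix.mul_diagonal, hP.apply_self, one_mul]
  have hcomm : T * Y * (P * D) = P * D * Y := by
    rw [← mul_assoc, hTYP, mul_assoc, mul_assoc, Matrix.diagonal_mul_diagonal,
      Matrix.diagonal_mul_diagonal]
    simp only [Matrix.diag_apply, hTYii, hxy]
  obtain ⟨X, hXeq⟩ := isUnit_of_blockTriangular hb hX fun i => hXii i ▸ hne hxr i
  obtain ⟨Y', hYeq⟩ := isUnit_of_blockTriangular hb (Matrix.blockTriangular_diagonal y)
    fun i => (Matrix.diagonal_apply_eq y i).symm ▸ hne hyr i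
  refine ⟨X, Y', ?_, ⟨y, hy, hYeq ▸ IsConj.refl _⟩, ?_⟩
  · rw [hXeq]
    exact isPureDiagonalizable_of_blockTriangular hb hX (fun i => hXii i ▸ hx i)
      fun i j hij => hr (by simpa [hXii, hxr] using hij)
  · rw [commutatorElement_def, Units.val_mul, Units.val_mul, Units.val_mul,
      Units.eq_mul_inv_iff_mul_eq, Units.eq_mul_inv_iff_mul_eq, hXeq, hYeq, hcomm]

theorem map_eq_one_of_blockTriangular {M : Type*} [CommMonoid M] (f : Matrix ι ι ℍ[ℝ] →* M)
    {T : Matrix ι ι ℍ[ℝ]} (hb : b.Injective) (hT : T.BlockTriangular b)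
    (hdiag : ∀ i, ‖T i i‖ = 1) : f T = 1 := by
  obtain ⟨X, Y, -, -, rfl⟩ := exists_commutator_of_blockTriangular hb hT hdiag
  rw [← Units.coe_map, map_commutatorElement, commutatorElement_eq_one_iff_commute.mpr (.all _ _),
    Units.val_one]

end PureDiagonalizable

section Conjugation

variable {ι κ R : Type*} [Fintype ι] [DecidableEq ι] [Fintype κ] [DecidableEq κ] [Ring R]

theorem isConj_submatrix {B C : Matrix ι ι R} (h : IsConj B C) (e : κ ≃ ι) :
    IsConj (B.submatrix e e) (C.submatrix e e) := by
  let f : Matrix ι ι R →* Matrix κ κ R :=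
    { toFun := fun M => M.submatrix e e
      map_one' := Matrix.submatrix_one_equiv e
      map_mul' := fun M N => (Matrix.submatrix_mul_equiv M N e e e).symm }
  exact f.map_isConj h

theorem isConj_fromBlocks {A : Matrix ι ι R} {B : Matrix ι κ R} {C : Matrix κ ι R}
    {D D' P : Matrix κ κ R} (hP : IsUnit P) (hD : P * D = D' * P) :
    IsConj (Matrix.fromBlocks A (B * P) C D) (Matrix.fromBlocks A B (P * C) D') := by
  obtain ⟨⟨P, P', hPP', hP'P⟩, rfl⟩ := hP
  let Q : (Matrix (ι ⊕ κ) (ι ⊕ κ) R)ˣ :=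
    ⟨Matrix.fromBlocks 1 0 0 P, Matrix.fromBlocks 1 0 0 P',
      by simp [Matrix.fromBlocks_multiply, hPP'], by simp [Matrix.fromBlocks_multiply, hP'P]⟩
  exact ⟨Q, by simpa [Q, SemiconjBy, Matrix.fromBlocks_multiply] using hD⟩

theorem isConj_one_add_single {i j : ι} (hij : i ≠ j) (c : R) (B : Matrix ι ι R) :
    IsConj B ((1 + Matrix.single i j c) * B * (1 - Matrix.single i j c)) := by
  have hsq : Matrix.single i j c * Matrix.single i j c = 0 :=
    Matrix.single_mul_single_of_ne _ _ _ _ hij.symm _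
  have hinv : (1 - Matrix.single i j c) * (1 + Matrix.single i j c) = 1 := by
    simp [sub_mul, mul_add, hsq]
  refine ⟨⟨1 + Matrix.single i j c, 1 - Matrix.single i j c, ?_, hinv⟩, ?_⟩
  · simp [mul_sub, add_mul, hsq]
  · rw [SemiconjBy, mul_assoc _ (1 - Matrix.single i j c), hinv]
    exact (mul_one _).symm

theorem exists_isConj_apply_ne_zero {B : Matrix ι ι R} (hB : B ∉ Set.range (Matrix.scalar ι)) :
    ∃ C i j, IsConj B C ∧ i ≠ j ∧ C i j ≠ 0 := by
  by_contra! hC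
  have hoff (k l) (hkl : k ≠ l) : B k l = 0 := hC B k l (.refl B) hkl
  have hdiag (k l) (hkl : k ≠ l) : B l l = B k k := by
    have hconj := hC _ k l (isConj_one_add_single hkl 1 B) hkl
    simpa [add_mul, mul_sub, hoff k l hkl, hoff l k hkl.symm, sub_eq_zero] using hconj
  rcases isEmpty_or_nonempty ι with _ | ⟨⟨i⟩⟩
  · exact hB ⟨0, Subsingleton.elim _ _⟩
  refine hB ⟨B i i, Matrix.ext fun k l => ?_⟩
  rw [Matrix.scalar_apply, Matrix.diagonal_apply]
  rcases eq_or_ne k l with rfl | hkl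
  · rcases eq_or_ne k i with rfl | hki
    · exact if_pos rfl
    · rw [if_pos rfl, hdiag k i hki]
  · rw [if_neg hkl, hoff k l hkl]

theorem exists_isConj_apply_eq_one {K : Type*} [DivisionRing K] {B : Matrix ι ι K}
    (hB : B ∉ Set.range (Matrix.scalar ι)) : ∃ C j, IsConj B C ∧ C j j = 1 := by
  obtain ⟨C, i, j, hBC, hij, hCij⟩ := exists_isConj_apply_ne_zero hB
  refine ⟨_, j, hBC.trans (isConj_one_add_single hij.symm ((1 - C j j) * (C i j)⁻¹) C), ?_⟩
  simp [add_mul, mul_sub, hij, hij.symm, hCij]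

end Conjugation

section LDU

variable {ι κ υ K : Type*} [Fintype ι] [DecidableEq ι] [Fintype κ] [DecidableEq κ] [Fintype υ]
  [DecidableEq υ] [Ring K]

/-- Similarity to a product `L D U` of a lower unitriangular, a diagonal and an upper unitriangular
matrix. The diagonal entries of `D` other than `1` are required to coincide, so that the
determinant of `D` controls each of them. -/
def IsSimilarToLDU (B : Matrix ι ι K) : Prop :=
  ∃ (b : ι → ℕ) (L U : Matrix ι ι K) (d : ι → K) (q : K), b.Injective ∧
    IsUnitriangular (OrderDual.toDual ∘ b) L ∧ IsUnitriangular b U ∧ (∀ i, d i = 1 ∨ d i = q) ∧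
    IsConj (L * Matrix.diagonal d * U) B

theorem IsSimilarToLDU.of_isConj {B C : Matrix ι ι K} (hB : IsSimilarToLDU B) (h : IsConj B C) :
    IsSimilarToLDU C :=
  let ⟨b, L, U, d, q, hb, hL, hU, hd, hLDU⟩ := hB
  ⟨b, L, U, d, q, hb, hL, hU, hd, hLDU.trans h⟩

theorem isSimilarToLDU_scalar (q : K) : IsSimilarToLDU (Matrix.scalar ι q) :=
  ⟨fun i => Fintype.equivFin ι i, 1, 1, fun _ => q, q,
    Fin.val_injective.comp (Fintype.equivFin ι).injective, isUnitriangular_one _,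
    isUnitriangular_one _, fun _ => .inr rfl, by simp [Matrix.scalar_apply, IsConj.refl]⟩

theorem IsSimilarToLDU.submatrix {B : Matrix ι ι K} (hB : IsSimilarToLDU B) (e : κ ≃ ι) :
    IsSimilarToLDU (B.submatrix e e) := by
  obtain ⟨b, L, U, d, q, hb, hL, hU, hd, hLDU⟩ := hB
  refine ⟨b ∘ e, L.submatrix e e, U.submatrix e e, d ∘ e, q, hb.comp e.injective, hL.submatrix e,
    hU.submatrix e, fun i => hd (e i), ?_⟩
  rw [← Matrix.submatrix_diagonal_equiv, Matrix.submatrix_mul_equiv, Matrix.submatrix_mul_equiv]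
  exact isConj_submatrix hLDU e

theorem IsSimilarToLDU.fromBlocks [Subsingleton υ] {A : Matrix κ κ K} {R : Matrix κ υ K}
    {C : Matrix υ κ K} (h : IsSimilarToLDU (A - R * C)) :
    IsSimilarToLDU (Matrix.fromBlocks 1 C R A) := by
  obtain ⟨b, L, U, d, q, hb, hL, hU, hd, ⟨P, P', hPP', hP'P⟩, hP⟩ := h
  refine ⟨Sum.elim (fun _ => 0) fun i => b i + 1, Matrix.fromBlocks 1 0 (P' * R) L,
    Matrix.fromBlocks 1 (C * P) 0 U, Sum.elim 1 d, q, ?_, ?_, ?_, ?_, ?_⟩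
  · exact (Function.injective_of_subsingleton _).sumElim (Nat.succ_injective.comp hb)
      fun _ i => (b i).succ_ne_zero.symm
  · rw [Sum.comp_elim]
    exact (isUnitriangular_one _).fromBlocks_zero₁₂
      (hL.of_lt_imp_lt fun _ _ => Nat.succ_lt_succ_iff.mp) (fun _ i => Nat.zero_le (b i + 1)) _
  · exact (isUnitriangular_one _).fromBlocks_zero₂₁
      (hU.of_lt_imp_lt fun _ _ => Nat.succ_lt_succ_iff.mp) (fun _ i => Nat.zero_le (b i + 1)) _
  · rintro (i | i)
    exacts [.inl rfl, hd i]
  · have hdiag : Matrix.diagonal (Sum.elim 1 d) =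
        Matrix.fromBlocks (1 : Matrix υ υ K) 0 0 (Matrix.diagonal d) := by
      rw [← Matrix.fromBlocks_diagonal]
      rfl
    have hA : P * (L * Matrix.diagonal d * U + P' * R * (C * P)) = A * P := by
      have hPLDU : P * (L * Matrix.diagonal d * U) = (A - R * C) * P := hP
      rw [mul_add, hPLDU, Matrix.mul_assoc P', ← mul_assoc, hPP', one_mul, ← Matrix.mul_assoc,
        ← add_mul, sub_add_cancel]
    have hconj := isConj_fromBlocks (A := (1 : Matrix υ υ K)) (B := C) (C := P' * R)
      ⟨⟨P, P', hPP', hP'P⟩, rfl⟩ hA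
    simpa [hdiag, Matrix.fromBlocks_multiply, add_comm, ← Matrix.mul_assoc, hPP'] using hconj

theorem isSimilarToLDU {K : Type*} [DivisionRing K] (B : Matrix ι ι K) : IsSimilarToLDU B := by
  induction hn : Fintype.card ι using Nat.strong_induction_on generalizing ι with | _ n ih
  by_cases hB : B ∈ Set.range (Matrix.scalar ι)
  · obtain ⟨q, rfl⟩ := hB
    exact isSimilarToLDU_scalar q
  obtain ⟨C, j, hBC, hCj⟩ := exists_isConj_apply_eq_one hB
  let e : {i // i = j} ⊕ {i // ¬ i = j} ≃ ι := Equiv.sumCompl (· = j)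
  have hcard : Fintype.card {i // ¬ i = j} < n :=
    hn ▸ Fintype.card_subtype_lt (x := j) (not_not.mpr rfl)
  have hone : (C.submatrix e e).toBlocks₁₁ = 1 := by
    ext ⟨i, rfl⟩ ⟨k, rfl⟩
    simpa [Matrix.toBlocks₁₁, e] using hCj
  have hblocks : IsSimilarToLDU (C.submatrix e e) := by
    rw [← Matrix.fromBlocks_toBlocks (C.submatrix e e), hone]
    exact .fromBlocks (ih _ hcard _ rfl)
  have := hblocks.submatrix e.symm
  rw [Matrix.submatrix_submatrix, e.self_comp_symm, Matrix.submatrix_id_id] at this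
  exact this.of_isConj hBC.symm

end LDU

section RealDet

variable {ι α : Type*} [Fintype ι] [DecidableEq ι] [LinearOrder α] {b : ι → α}

/-- The determinant of the real linear endomorphism of column vectors given by a quaternionic
matrix. It is the fourth power of the reduced (Dieudonné) determinant with values in `ℝ≥0`. -/
noncomputable def realDet : Matrix ι ι ℍ[ℝ] →* ℝ :=
  Matrix.detMonoidHom.comp <| RingHom.toMonoidHom <| AlgHom.toRingHom <|
    (Matrix.compAlgEquiv ι (Fin 4) ℝ ℝ).toAlgHom.comp
      (Algebra.leftMulMatrix quaternionBasis).mapMatrix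

theorem realDet_apply (B : Matrix ι ι ℍ[ℝ]) :
    realDet B = (Matrix.comp ι ι (Fin 4) (Fin 4) ℝ
      (B.map (Algebra.leftMulMatrix quaternionBasis))).det :=
  rfl

theorem realDet_eq_of_isConj {A B : Matrix ι ι ℍ[ℝ]} (h : IsConj A B) : realDet A = realDet B :=
  isConj_iff_eq.mp (realDet.map_isConj h)

theorem IsUnitriangular.realDet_eq_one {M : Matrix ι ι ℍ[ℝ]} (hM : IsUnitriangular b M)
    (hb : b.Injective) : realDet M = 1 :=
  map_eq_one_of_blockTriangular realDet hb hM.blockTriangular fun i => by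
    rw [hM.apply_self, norm_one]

theorem realDet_diagonal_algebraMap (r : ι → ℝ) :
    realDet (Matrix.diagonal fun i => algebraMap ℝ ℍ[ℝ] (r i)) = (∏ i, r i) ^ 4 := by
  have hmap : (Matrix.diagonal fun i => algebraMap ℝ ℍ[ℝ] (r i)).map
      (Algebra.leftMulMatrix quaternionBasis) =
      Matrix.diagonal fun i => Matrix.diagonal fun _ => r i := by
    rw [Matrix.diagonal_map (map_zero _)]
    refine congrArg _ (funext fun i => ?_)
    rw [AlgHom.commutes, Matrix.algebraMap_eq_diagonal]
    rfl
  rw [realDet_apply, hmap, Matrix.comp_diagonal_diagonal, Matrix.det_diagonal,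
    Fintype.prod_prod_type, ← Finset.prod_pow]
  simp only [Finset.prod_const, Finset.card_univ, Fintype.card_fin]

theorem exists_norm_eq_one_eq_norm_mul (q : ℍ[ℝ]) :
    ∃ u : ℍ[ℝ], ‖u‖ = 1 ∧ algebraMap ℝ ℍ[ℝ] ‖q‖ * u = q := by
  rcases eq_or_ne q 0 with rfl | hq
  · exact ⟨1, norm_one, by simp⟩
  · refine ⟨‖q‖⁻¹ • q, norm_smul_inv_norm hq, ?_⟩
    rw [← Algebra.smul_def, smul_inv_smul₀ (norm_ne_zero_iff.mpr hq)]

theorem realDet_diagonal (d : ι → ℍ[ℝ]) : realDet (Matrix.diagonal d) = (∏ i, ‖d i‖) ^ 4 := by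
  choose u hu hdu using fun i => exists_norm_eq_one_eq_norm_mul (d i)
  have hunit : realDet (Matrix.diagonal u) = 1 :=
    map_eq_one_of_blockTriangular realDet (Fintype.equivFin ι).injective
      (Matrix.blockTriangular_diagonal u) fun i => by rw [Matrix.diagonal_apply_eq, hu]
  have hpolar : Matrix.diagonal d =
      Matrix.diagonal (fun i => algebraMap ℝ ℍ[ℝ] ‖d i‖) * Matrix.diagonal u := by
    rw [Matrix.diagonal_mul_diagonal, funext hdu]
  rw [hpolar, map_mul, hunit, mul_one, realDet_diagonal_algebraMap]

theorem abs_realDet_permMatrix (σ : Equiv.Perm ι) : |realDet (σ.permMatrix ℍ[ℝ])| = 1 := by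
  let f : Equiv.Perm ι →* ℝ :=
    { toFun := fun τ => realDet (τ.permMatrix ℍ[ℝ])
      map_one' := by rw [Matrix.permMatrix_one, map_one]
      map_mul' := fun τ ρ => by rw [Matrix.permMatrix_mul, map_mul, mul_comm] }
  exact (f.isOfFinOrder (isOfFinOrder_of_finite σ)).norm_eq_one

end RealDet

section Commutators

theorem eq_one_of_prod_eq_one {ι : Type*} [Fintype ι] {x : ι → ℝ} {c : ℝ} (hc : 0 ≤ c)
    (hx : ∀ i, x i = 1 ∨ x i = c) (h : ∏ i, x i = 1) (i : ι) : x i = 1 := by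
  classical
  have hprod : c ^ (Finset.univ.filter (x · ≠ 1)).card = 1 :=
    (Finset.prod_eq_pow_card fun j hj => (hx j).resolve_left (Finset.mem_filter.mp hj).2).symm.trans
      ((Finset.prod_filter_ne_one _).trans h)
  by_contra hi
  have hcard : (Finset.univ.filter (x · ≠ 1)).card ≠ 0 :=
    Finset.card_ne_zero_of_mem (Finset.mem_filter.mpr ⟨Finset.mem_univ i, hi⟩)
  exact hi (((hx i).resolve_left hi).trans ((pow_eq_one_iff_of_nonneg hc hcard).mp hprod))

theorem exists_perm_forall_apply_ne (ι : Type*) [Finite ι] [Nontrivial ι] :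
    ∃ σ : Equiv.Perm ι, ∀ i, σ i ≠ i := by
  classical
  have := Fintype.ofFinite ι
  obtain ⟨σ, hσ, -⟩ := (Finset.univ : Finset ι).exists_cycleOn
  exact ⟨σ, fun i => hσ.apply_ne (by simpa using Set.nontrivial_univ) (by simp)⟩

theorem exists_isUnitriangular_sub_eq {ι α K : Type*} [LinearOrder α] [Ring K] (b : ι → α)
    {N : Matrix ι ι K} (hN : ∀ i, N i i = 0) :
    ∃ V W, IsUnitriangular b V ∧ IsUnitriangular (OrderDual.toDual ∘ b) W ∧ V - W = N := by
  classical
  let V : Matrix ι ι K := 1 + .of fun i j => if b i < b j then N i j else 0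
  have hV : IsUnitriangular b V :=
    ⟨Matrix.blockTriangular_one.add fun i j hij => if_neg hij.not_gt, fun i => by simp [V]⟩
  refine ⟨V, V - N, hV, ⟨fun i j hij => ?_, fun i => ?_⟩, sub_sub_cancel V N⟩
  · have hij : b i < b j := hij
    simp [V, hij, ne_of_apply_ne b hij.ne]
  · rw [Matrix.sub_apply, hV.apply_self, hN, sub_zero]

variable {ι : Type*} [Fintype ι] [DecidableEq ι]

theorem exists_isConj_mul_of_abs_realDet_eq_one {B : Matrix ι ι ℍ[ℝ]} (hB : |realDet B| = 1) :
    ∃ (b : ι → ℕ) (S T : Matrix ι ι ℍ[ℝ]), b.Injective ∧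
      S.BlockTriangular (OrderDual.toDual ∘ b) ∧ (∀ i, ‖S i i‖ = 1) ∧
      T.BlockTriangular b ∧ (∀ i, ‖T i i‖ = 1) ∧ IsConj (S * T) B := by
  obtain ⟨b, L, U, d, q, hb, hL, hU, hd, hLDU⟩ := isSimilarToLDU B
  have hprod : ∏ i, ‖d i‖ = 1 := by
    rw [← realDet_eq_of_isConj hLDU, map_mul, map_mul, hU.realDet_eq_one hb,
      hL.realDet_eq_one (OrderDual.toDual.injective.comp hb), one_mul, mul_one, realDet_diagonal,
      abs_of_nonneg (by positivity)] at hB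
    exact (pow_eq_one_iff_of_nonneg (by positivity) four_ne_zero).mp hB
  have hnorm := eq_one_of_prod_eq_one (norm_nonneg q)
    (fun i => (hd i).imp (fun h => by rw [h, norm_one]) (congrArg _)) hprod
  refine ⟨b, L * Matrix.diagonal d, U, hb, hL.blockTriangular.mul
    (Matrix.blockTriangular_diagonal d), fun i => ?_, hU.blockTriangular, fun i => ?_, hLDU⟩
  · rw [Matrix.mul_diagonal, hL.apply_self, one_mul, hnorm]
  · rw [hU.apply_self, norm_one]

theorem exists_commutators_of_abs_realDet_eq_one {B : Matrix ι ι ℍ[ℝ]} (hB : |realDet B| = 1) :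
    ∃ X : Fin 4 → (Matrix ι ι ℍ[ℝ])ˣ, (∀ i, IsPureDiagonalizable (X i : Matrix ι ι ℍ[ℝ])) ∧
      B = ↑(⁅X 0, X 1⁆ * ⁅X 2, X 3⁆) := by
  obtain ⟨b, S, T, hb, hS, hSdiag, hT, hTdiag, P, hP⟩ :=
    exists_isConj_mul_of_abs_realDet_eq_one hB
  obtain ⟨X₁, Y₁, hX₁, hY₁, rfl⟩ :=
    exists_commutator_of_blockTriangular (OrderDual.toDual.injective.comp hb) hS hSdiag
  obtain ⟨X₂, Y₂, hX₂, hY₂, rfl⟩ := exists_commutator_of_blockTriangular hb hT hTdiag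
  have hpure {X : (Matrix ι ι ℍ[ℝ])ˣ} (hX : IsPureDiagonalizable (X : Matrix ι ι ℍ[ℝ])) :
      IsPureDiagonalizable (MulAut.conj P X : Matrix ι ι ℍ[ℝ]) :=
    hX.of_isConj ⟨P, by simp [SemiconjBy, ← Units.val_mul]⟩
  refine ⟨MulAut.conj P ∘ ![X₁, Y₁, X₂, Y₂], fun i => ?_, ?_⟩
  · fin_cases i
    exacts [hpure hX₁, hpure hY₁, hpure hX₂, hpure hY₂]
  · change B = ↑(⁅MulAut.conj P X₁, MulAut.conj P Y₁⁆ * ⁅MulAut.conj P X₂, MulAut.conj P Y₂⁆)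
    rw [← map_commutatorElement, ← map_commutatorElement, ← map_mul, MulAut.conj_apply,
      Units.val_mul, Units.eq_mul_inv_iff_mul_eq, Units.val_mul, Units.val_mul, hP.eq]

theorem exists_abs_realDet_eq_one_sub_eq [Nontrivial ι] (B : Matrix ι ι ℍ[ℝ]) :
    ∃ X Y, |realDet X| = 1 ∧ |realDet Y| = 1 ∧ X - Y = B := by
  obtain ⟨b, L, U, d, -, hb, hL, hU, -, P, hP⟩ := isSimilarToLDU B
  obtain ⟨σ, hσ⟩ := exists_perm_forall_apply_ne ι
  let S : Matrix ι ι ℍ[ℝ] := σ⁻¹.permMatrix ℍ[ℝ]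
  have hσS : σ.permMatrix ℍ[ℝ] * S = 1 := by
    rw [← Matrix.permMatrix_mul, inv_mul_cancel, Matrix.permMatrix_one]
  -- The factor `σ` clears the diagonal of `D`, which makes `D σ` a difference of unitriangulars.
  obtain ⟨V, W, hV, hW, hVW⟩ := exists_isUnitriangular_sub_eq b
    (N := Matrix.diagonal d * σ.permMatrix ℍ[ℝ]) fun i => by
      simp [Matrix.diagonal_mul, hσ, Equiv.toPEquiv_apply]
  have hbdual := OrderDual.toDual.injective.comp hb
  have hdet {M : Matrix ι ι ℍ[ℝ]} (hM : realDet M = 1) :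
      |realDet (P.val * (L * (M * S) * U) * P⁻¹.val)| = 1 := by
    rw [← realDet_eq_of_isConj (A := L * (M * S) * U) ⟨P, by simp [SemiconjBy]⟩]
    simp [S, hM, hL.realDet_eq_one hbdual, hU.realDet_eq_one hb, abs_realDet_permMatrix]
  refine ⟨_, _, hdet (hV.realDet_eq_one hb), hdet (hW.realDet_eq_one hbdual), ?_⟩
  rw [← sub_mul, ← mul_sub, ← sub_mul, ← mul_sub, ← sub_mul, hVW, mul_assoc _ _ S, hσS, mul_one,
    hP.eq, Units.mul_inv_cancel_right]

theorem realDet_eq_one_of_mem_quatSL {n : ℕ} {B : QuatGL n} (hB : B ∈ QuatSL n) :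
    realDet (B : Matrix (Fin n) (Fin n) ℍ[ℝ]) = 1 :=
  congrArg Units.val (Abelianization.commutator_subset_ker
    (Units.map (realDet : Matrix (Fin n) (Fin n) ℍ[ℝ] →* ℝ)) hB)

end Commutators

theorem theorem6p4 (n : ℕ) (hn : 2 ≤ n) :
    (∀ p : Fin 4 → FreeAlgebra ℝ ℕ,
      (∀ i, IsMultilinearPoly (p i)) →
      (∀ i, polyImage (p i) ℍ[ℝ] ≠ {0}) →
      (∀ i, polyImage (p i) ℍ[ℝ] ≠ Set.range (algebraMap ℝ ℍ[ℝ])) →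
      ∀ B ∈ QuatSL n, ∃ A : Fin 4 → QuatGL n,
        (∀ i, (A i : Matrix (Fin n) (Fin n) ℍ[ℝ]) ∈
          polyImage (p i) (Matrix (Fin n) (Fin n) ℍ[ℝ])) ∧
        B = (A 0 * A 1 * (A 0)⁻¹ * (A 1)⁻¹) * (A 2 * A 3 * (A 2)⁻¹ * (A 3)⁻¹)) ∧
    (∀ p : Fin 8 → FreeAlgebra ℝ ℕ,
      (∀ i, IsMultilinearPoly (p i)) →
      (∀ i, polyImage (p i) ℍ[ℝ] ≠ {0}) →
      (∀ i, polyImage (p i) ℍ[ℝ] ≠ Set.range (algebraMap ℝ ℍ[ℝ])) →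
      ∀ B : Matrix (Fin n) (Fin n) ℍ[ℝ], ∃ A : Fin 8 → QuatGL n,
        (∀ i, (A i : Matrix (Fin n) (Fin n) ℍ[ℝ]) ∈
          polyImage (p i) (Matrix (Fin n) (Fin n) ℍ[ℝ])) ∧
        B = (((A 0 * A 1 * (A 0)⁻¹ * (A 1)⁻¹) * (A 2 * A 3 * (A 2)⁻¹ * (A 3)⁻¹) : QuatGL n) :
              Matrix (Fin n) (Fin n) ℍ[ℝ]) -
            (((A 4 * A 5 * (A 4)⁻¹ * (A 5)⁻¹) * (A 6 * A 7 * (A 6)⁻¹ * (A 7)⁻¹) : QuatGL n) :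
              Matrix (Fin n) (Fin n) ℍ[ℝ])) := by
  refine ⟨fun p hp h0 hR B hB => ?_, fun p hp h0 hR B => ?_⟩
  · obtain ⟨X, hX, hBX⟩ := exists_commutators_of_abs_realDet_eq_one
      (by rw [realDet_eq_one_of_mem_quatSL hB, abs_one])
    exact ⟨X, fun i => (hX i).mem_polyImage (hp i) (h0 i) (hR i), Units.ext hBX⟩
  · have : Nontrivial (Fin n) := Fin.nontrivial_iff_two_le.mpr hn
    obtain ⟨C, D, hC, hD, rfl⟩ := exists_abs_realDet_eq_one_sub_eq B
    obtain ⟨X, hX, rfl⟩ := exists_commutators_of_abs_realDet_eq_one hC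
    obtain ⟨Y, hY, rfl⟩ := exists_commutators_of_abs_realDet_eq_one hD
    refine ⟨Fin.append X Y, fun i => ?_, rfl⟩
    refine IsPureDiagonalizable.mem_polyImage ?_ (hp i) (h0 i) (hR i)
    induction i using Fin.addCases (m := 4) (n := 4) with
    | left i => rw [Fin.append_left]; exact hX i
    | right i => rw [Fin.append_right]; exact hY i
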